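/- Let $S\subset\mathbb{R}^n$ be a compact (hence convex) polyhedron, i.e. a bounded solution set of finitely many linear inequalities, and consider the linear objective $f(x,\theta)=\theta^\top x$, to be minimized over $x\in S$. Let $P\in\mathbb{R}^{n\times m}$ be a fixed reparameterization matrix such that the surrogate problem $\min\{\theta^\top P y : y\in\mathbb{R}^m,\ Py\in S\}$ is feasible. Let $y^*(\theta)$ denote an optimal solution of the surrogate problem, where ties are broken by a fixed choice function applied to the set of optimal solutions (so that $y^*(\theta)$ depends on $\theta$ only through the set of optimal solutions). Let $\Theta\subset\mathbb{R}^n$ be such that the optimality gap $$C=\sup_{\theta\in\Theta}\Bigl(\max_{x\in S}\theta^\top x-\min_{x\in S}\theta^\top x\Bigr)$$ is finite, and let $\mathcal{D}$ be a probability distribution of $(\xi,\theta)\in\mathbb{R}^p\times\mathbb{R}^n$ with $\theta\in\Theta$ almost surely. Let $\mathcal{H}_{\mathrm{lin}}=\{\xi\mapsto B\xi : B\in\mathbb{R}^{n\times p}\}$ and, for $\Phi\in\mathcal{H}_{\mathrm{lin}}$, define the decision loss of the surrogate by $\ell(\Phi,(\xi,\theta))=\theta^\top P\,y^*(\Phi(\xi))$.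 The expected Rademacher complexity is $$\mathrm{Rad}^t(\mathcal{H}_{\mathrm{lin}})=\mathbb{E}_{(\xi_i,\theta_i)\sim\mathcal{D}\text{ i.i.d.}}\ \mathbb{E}_{\sigma}\ \sup_{\Phi\in\mathcal{H}_{\mathrm{lin}}}\frac1t\sum_{i=1}^t\sigma_i\,\ell(\Phi,(\xi_i,\theta_i)),$$ with $\sigma$ uniform on $\{-1,1\}^t$. (Subtracting from $\ell$ a term that depends only on $\theta$, such as the optimal value for $\theta$, does not change it, so the same quantity is obtained for the regret.) Then the expectation over the samples is well defined (the integrand is integrable), and $$\mathrm{Rad}^t(\mathcal{H}_{\mathrm{lin}})\le 2mC\sqrt{\frac{2p\,\log\bigl(2mt\,\|P^+\|\,\rho_2(S)\bigr)}{t}}+O\!\left(\frac1t\right),$$ where $\rho_2(S)$ is the Euclidean diameter of $S$, $P^+$ is the Moore–Penrose pseudoinverse of $P$ and $\|P^+\|$ its spectral norm. Here $O(1/t)$ stands for $K/t$ with a constant $K$ that may depend on $n,m,p,S,P,\Theta$, but not on $t$, on $\mathcal{D}$ or on the choice function; the bound holds for all $t\ge1$, the square root being read as $0$ if the logarithm is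 negative or its argument is $0$. -/

import Mathlib

open MeasureTheory
open scoped RealInnerProductSpace

noncomputable section

namespace SurrogateLearning

/-- `ℝᵈ` with the Euclidean norm. -/
abbrev Vec (d : ℕ) : Type := EuclideanSpace ℝ (Fin d)

/-- A (closed, convex) polyhedron in `ℝᵈ`: the solution set of finitely many linear inequalities. -/
def IsPolyhedron {d : ℕ} (S : Set (Vec d)) : Prop :=
  ∃ (k : ℕ) (a : Fin k → Vec d) (b : Fin k → ℝ), S = {x | ∀ i, ⟪a i, x⟫ ≤ b i}

/-- The linear map `y ↦ P y` of a matrix, between Euclidean spaces. -/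
def lin {n m : ℕ} (P : Matrix (Fin n) (Fin m) ℝ) : Vec m →L[ℝ] Vec n :=
  LinearMap.toContinuousLinearMap (Matrix.toLpLin 2 2 P)

/-! ### Moore–Penrose pseudoinverse -/

/-- Some linear right inverse of `T` on its range. -/
def rangeSection {d e : ℕ} (T : Vec d →L[ℝ] Vec e) :
    LinearMap.range T.toLinearMap →ₗ[ℝ] Vec d :=
  (T.toLinearMap.rangeRestrict.exists_rightInverse_of_surjective
    T.toLinearMap.range_rangeRestrict).choose

/-- The Moore–Penrose pseudoinverse of a linear map: project orthogonally onto the range, take a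
preimage, and remove from the preimage its component in the kernel. It is the unique map
with the four Penrose properties, which are proved below. -/
def pinv {d e : ℕ} (T : Vec d →L[ℝ] Vec e) : Vec e →L[ℝ] Vec d :=
  (LinearMap.ker T.toLinearMap)ᗮ.starProjection ∘L
    LinearMap.toContinuousLinearMap (rangeSection T) ∘L
    (LinearMap.range T.toLinearMap).orthogonalProjectionOnto

theorem apply_rangeSection {d e : ℕ} (T : Vec d →L[ℝ] Vec e)
    (x : LinearMap.range T.toLinearMap) : T (rangeSection T x) = x := by
  have h := (T.toLinearMap.rangeRestrict.exists_rightInverse_of_surjective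
    T.toLinearMap.range_rangeRestrict).choose_spec
  exact congrArg Subtype.val (LinearMap.congr_fun h x)

theorem apply_starProjection_ker_orthogonal {d e : ℕ} (T : Vec d →L[ℝ] Vec e) (y : Vec d) :
    T ((LinearMap.ker T.toLinearMap)ᗮ.starProjection y) = T y := by
  have h : (LinearMap.ker T.toLinearMap).starProjection y ∈ LinearMap.ker T.toLinearMap :=
    Submodule.starProjection_apply_mem _ y
  have h' : T ((LinearMap.ker T.toLinearMap).starProjection y) = 0 := h
  rw [Submodule.starProjection_orthogonal_val, map_sub, h', sub_zero]

theorem apply_pinv {d e : ℕ} (T : Vec d →L[ℝ] Vec e) (x : Vec e) :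
    T (pinv T x) = (LinearMap.range T.toLinearMap).starProjection x := by
  have h : pinv T x = (LinearMap.ker T.toLinearMap)ᗮ.starProjection
      (rangeSection T ((LinearMap.range T.toLinearMap).orthogonalProjectionOnto x)) := rfl
  rw [h, apply_starProjection_ker_orthogonal, apply_rangeSection]
  rfl

theorem pinv_apply {d e : ℕ} (T : Vec d →L[ℝ] Vec e) (y : Vec d) :
    pinv T (T y) = (LinearMap.ker T.toLinearMap)ᗮ.starProjection y := by
  have h1 : pinv T (T y) = (LinearMap.ker T.toLinearMap)ᗮ.starProjection
      (rangeSection T ((LinearMap.range T.toLinearMap).orthogonalProjectionOnto (T y))) := rfl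
  have hy : T y ∈ LinearMap.range T.toLinearMap := ⟨y, rfl⟩
  have h2 : T (rangeSection T ((LinearMap.range T.toLinearMap).orthogonalProjectionOnto (T y))) =
      T y := by
    rw [apply_rangeSection]
    exact Submodule.starProjection_eq_self_iff.2 hy
  have h3 : rangeSection T ((LinearMap.range T.toLinearMap).orthogonalProjectionOnto (T y)) - y ∈
      LinearMap.ker T.toLinearMap := by
    rw [LinearMap.mem_ker]
    change T (_ - y) = 0
    rw [map_sub, h2, sub_self]
  have h4 := Submodule.starProjection_eq_self_iff.2 h3
  rw [h1, ← sub_eq_zero, ← map_sub, Submodule.starProjection_orthogonal_val, h4, sub_self]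

/-- The four Penrose equations. -/
theorem pinv_penrose {d e : ℕ} (T : Vec d →L[ℝ] Vec e) :
    T ∘L pinv T ∘L T = T ∧ pinv T ∘L T ∘L pinv T = pinv T ∧
      IsSelfAdjoint (T ∘L pinv T) ∧ IsSelfAdjoint (pinv T ∘L T) := by
  have h1 : T ∘L pinv T = (LinearMap.range T.toLinearMap).starProjection :=
    ContinuousLinearMap.ext (apply_pinv T)
  have h2 : pinv T ∘L T = (LinearMap.ker T.toLinearMap)ᗮ.starProjection :=
    ContinuousLinearMap.ext (pinv_apply T)
  refine ⟨?_, ?_, ?_, ?_⟩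
  · ext1 y
    change T (pinv T (T y)) = T y
    rw [pinv_apply, apply_starProjection_ker_orthogonal]
  · ext1 x
    change pinv T (T (pinv T x)) = pinv T x
    rw [pinv_apply]
    exact Submodule.starProjection_eq_self_iff.2 (Submodule.starProjection_apply_mem _ _)
  · rw [h1]
    exact isSelfAdjoint_starProjection _
  · rw [h2]
    exact isSelfAdjoint_starProjection _

/-! ### The optimization problem and its surrogate -/

/-- `ω_S(θ)`: worst minus best value of the objective `θᵀ x` over `S`. -/
def gap {n : ℕ} (S : Set (Vec n)) (θ : Vec n) : ℝ :=
  sSup ((fun x => ⟪θ, x⟫) '' S) - sInf ((fun x => ⟪θ, x⟫) '' S)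

/-- `C = ω_S(Θ)`: the supremum of the gaps `ω_S(θ)` over all parameters `θ ∈ Θ`. -/
def optimalityGap {n : ℕ} (S Θ : Set (Vec n)) : ℝ := sSup (gap S '' Θ)

/-- Optimal solutions of the surrogate problem: minimize `θᵀ P y` subject to `P y ∈ S`. -/
def surrogateArgmin {n m : ℕ} (S : Set (Vec n)) (P : Matrix (Fin n) (Fin m) ℝ) (θ : Vec n) :
    Set (Vec m) :=
  {y | lin P y ∈ S ∧ ∀ y', lin P y' ∈ S → ⟪θ, lin P y⟫ ≤ ⟪θ, lin P y'⟫}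

/-- Decision loss of a hypothesis `Φ` at a sample `(ξ, θ)`: predict `Φ ξ`, solve the surrogate
problem with this prediction (`sel` picks one of the optimal solutions `y`), and evaluate
the decision `P y` with the true parameter `θ`. -/
def decisionLoss {n m p : ℕ} (S : Set (Vec n)) (P : Matrix (Fin n) (Fin m) ℝ)
    (sel : Set (Vec m) → Vec m) (Φ : Vec p → Vec n) (z : Vec p × Vec n) : ℝ :=
  ⟪z.2, lin P (sel (surrogateArgmin S P (Φ z.1)))⟫

/-- The class of all linear hypotheses `ξ ↦ B ξ` from `ℝᵖ` to `ℝⁿ`. -/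
def linearHypotheses (p n : ℕ) : Set (Vec p → Vec n) :=
  {Φ | ∃ B : Matrix (Fin n) (Fin p) ℝ, Φ = lin B}

/-! ### Rademacher complexity -/

/-- Empirical Rademacher complexity of a hypothesis class `H` with loss `ℓ` on the sample
`z₁, …, z_t`: the average over all sign vectors `σ ∈ {-1, 1}ᵗ` of
`sup_{Φ ∈ H} (1/t) ∑ᵢ σᵢ ℓ(Φ, zᵢ)`. -/
def empiricalRademacher {Z A : Type*} {t : ℕ} (H : Set A) (ℓ : A → Z → ℝ) (z : Fin t → Z) : ℝ :=
  (∑ σ : Fin t → ℤˣ, ⨆ Φ : H, (1 / (t : ℝ)) * ∑ i, ((σ i : ℤ) : ℝ) * ℓ Φ (z i)) / 2 ^ t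

/-- Expected Rademacher complexity over `t` i.i.d. samples drawn from `D`. -/
def expectedRademacher {Z A : Type*} [MeasurableSpace Z] (D : Measure Z) (t : ℕ) (H : Set A)
    (ℓ : A → Z → ℝ) : ℝ :=
  ∫ z : Fin t → Z, empiricalRademacher H ℓ z ∂(Measure.pi fun _ => D)

end SurrogateLearning

end

/-! A linear objective on a polyhedron sees only finitely many comparisons. Choose one feasible `y`
for each set of constraints active at some feasible point. The optimal set of the surrogate problem
is determined by how the objective orders these representatives, that is, by the signs of `⟪η, P
u_j⟫` for `k` fixed vectors `u_j` (`exists_surrogateArgmin_eq_of_sign`). As ties are broken by a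
function of the optimal set, the decision is a function of these signs.

With `η = B ξᵢ`, the `t k` signs on a sample are signs of linear functionals of `Pᵀ B`, which lives
in a space of dimension `m p`. Hence at most `(2 t k + 1) ^ (m p)` loss vectors occur
(`ncard_range_sign_le`). After centring at a fixed hypothesis, losses are bounded by `C`, and
Massart's lemma gives `C √(2 m p log (2 t k + 1) / t)`.

The claimed main term has `4 m² p` in place of `m p`. The spare factor `4 m` absorbs `k` and any
positive constant inside the logarithm once `t` is large, so the precise value `2 m ‖P⁺‖ ρ₂(S)`
matters only through being positive. For smaller `t` the trivial bound `C` is at most `K / t`. If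
that constant is zero or `p = 0`, the decision does not depend on the hypothesis. -/

namespace SurrogateLearning

/-! ### Sign patterns of linear functionals -/

/-- The points with a given sign pattern form a convex cone, so a positive combination of `x` and
`y` stays in it. If `g` changes sign between them, the weights `|g y|` and `|g x|` make `g` vanish.
-/
theorem exists_sign_eq_of_sign_ne {E : Type*} [AddCommGroup E] [Module ℝ E] {M : ℕ}
    (f : Fin M → E →ₗ[ℝ] ℝ) (g : E →ₗ[ℝ] ℝ) {x y : E}
    (hxy : ∀ i, SignType.sign (f i x) = SignType.sign (f i y))
    (hg : SignType.sign (g x) ≠ SignType.sign (g y)) :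
    ∃ w, g w = 0 ∧ ∀ i, SignType.sign (f i w) = SignType.sign (f i x) := by
  rcases eq_or_ne (g x) 0 with hx | hx
  · exact ⟨x, hx, fun _ => rfl⟩
  rcases eq_or_ne (g y) 0 with hy | hy
  · exact ⟨y, hy, fun i => (hxy i).symm⟩
  refine ⟨|g y| • x + |g x| • y, ?_, fun i => ?_⟩
  · simp only [map_add, map_smul, smul_eq_mul]
    rcases lt_or_gt_of_ne hx with hx | hx <;> rcases lt_or_gt_of_ne hy with hy | hy
    · simp [sign_neg hx, sign_neg hy] at hg
    · rw [abs_of_neg hx, abs_of_pos hy]; ring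
    · rw [abs_of_pos hx, abs_of_neg hy]; ring
    · simp [sign_pos hx, sign_pos hy] at hg
  · have hx' := abs_pos.2 hx
    have hy' := abs_pos.2 hy
    have h := hxy i
    simp only [map_add, map_smul, smul_eq_mul]
    rcases lt_trichotomy (f i x) 0 with hf | hf | hf
    · rw [sign_neg hf] at h ⊢
      have := sign_eq_neg_one_iff.1 h.symm
      exact sign_neg (by nlinarith)
    · rw [hf, sign_zero] at h
      rw [hf, sign_eq_zero_iff.1 h.symm]
      simp
    · rw [sign_pos hf] at h ⊢
      have := sign_eq_one_iff.1 h.symm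
      exact sign_pos (by nlinarith)

/-- `M` linear functionals on an `N`-dimensional real vector space realize at most `(2 M + 1) ^ N`
sign patterns. -/
theorem ncard_range_sign_fin_le {M : ℕ} : ∀ {E : Type*} [AddCommGroup E] [Module ℝ E]
    [FiniteDimensional ℝ E] (f : Fin M → E →ₗ[ℝ] ℝ) {N : ℕ}, Module.finrank ℝ E ≤ N →
    (Set.range fun x i => SignType.sign (f i x)).ncard ≤ (2 * M + 1) ^ N := by
  induction M with
  | zero =>
    intro E _ _ _ f N _
    simpa using Set.ncard_le_one_of_subsingleton (Set.range fun x i => SignType.sign (f i x))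
  | succ M ih =>
    intro E _ _ _ f N hN
    classical
    set A := Set.range fun x (i : Fin M) => SignType.sign (f i.succ x) with hA
    have hAc : A.ncard ≤ (2 * M + 1) ^ N := ih (fun i => f i.succ) hN
    by_cases hg : f 0 = 0
    · calc (Set.range fun x i => SignType.sign (f i x)).ncard
          ≤ (Fin.cons (α := fun _ => SignType) 0 '' A).ncard := by
            refine Set.ncard_le_ncard ?_ (Set.toFinite _)
            rintro _ ⟨x, rfl⟩
            refine ⟨_, ⟨x, rfl⟩, ?_⟩
            funext i
            refine Fin.cases ?_ (fun i => ?_) i <;> simp [hg]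
        _ ≤ A.ncard := Set.ncard_image_le (Set.toFinite _)
        _ ≤ (2 * M + 1) ^ N := hAc
        _ ≤ _ := Nat.pow_le_pow_left (by omega) _
    · set A₀ := Set.range fun (x : LinearMap.ker (f 0)) (i : Fin M) =>
        SignType.sign (f i.succ x) with hA₀
      have hker : Module.finrank ℝ (LinearMap.ker (f 0)) + 1 = Module.finrank ℝ E :=
        Module.Dual.finrank_ker_add_one_of_ne_zero hg
      obtain ⟨N, rfl⟩ : ∃ k, N = k + 1 := ⟨N - 1, by omega⟩
      have hA₀c : A₀.ncard ≤ (2 * M + 1) ^ N :=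
        ih (fun i => (f i.succ).domRestrict (LinearMap.ker (f 0))) (by omega)
      -- A pattern of the other functionals not realized on the kernel of `f 0` forces the sign of
      -- `f 0`. Only patterns in `A₀` can extend in up to three ways, whence the count `|A| + 2
      -- |A₀|`.
      have hrep : ∀ s : Fin M → SignType, ∃ c : SignType, s ∉ A₀ →
          ∀ x, (fun i : Fin M => SignType.sign (f i.succ x)) = s → SignType.sign (f 0 x) = c := by
        intro s
        by_cases hs : ∃ x, (fun i : Fin M => SignType.sign (f i.succ x)) = s
        · obtain ⟨x, hx⟩ := hs
          refine ⟨SignType.sign (f 0 x), fun hs₀ y hy => ?_⟩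
          by_contra hne
          obtain ⟨w, hw, hws⟩ := exists_sign_eq_of_sign_ne (fun i : Fin M => f i.succ) (f 0)
            (x := y) (y := x) (fun i => congrFun (hy.trans hx.symm) i) hne
          exact hs₀ ⟨⟨w, hw⟩, (funext hws).trans hy⟩
        · exact ⟨0, fun _ x hx => (hs ⟨x, hx⟩).elim⟩
      choose c hc using hrep
      let c' : (Fin M → SignType) → SignType := fun s => if s ∈ A₀ then 0 else c s
      have hsub : (Set.range fun x i => SignType.sign (f i x)) ⊆
          (fun s => Fin.cons (α := fun _ => SignType) (c' s) s) '' A ∪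
            (Fin.cons (α := fun _ => SignType) 1 '' A₀ ∪
              Fin.cons (α := fun _ => SignType) (-1) '' A₀) := by
        rintro _ ⟨x, rfl⟩
        have hx : (fun i => SignType.sign (f i x)) = Fin.cons (α := fun _ => SignType)
            (SignType.sign (f 0 x)) (fun i : Fin M => SignType.sign (f i.succ x)) := by
          funext i
          refine Fin.cases ?_ (fun i => ?_) i <;> simp
        beta_reduce
        rw [hx]
        by_cases hs : (fun i : Fin M => SignType.sign (f i.succ x)) ∈ A₀
        · rcases lt_trichotomy (f 0 x) 0 with h0 | h0 | h0
          · exact .inr (.inr ⟨_, hs, by rw [sign_neg h0]⟩)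
          · exact .inl ⟨_, ⟨x, rfl⟩, by simp [c', hs, h0]⟩
          · exact .inr (.inl ⟨_, hs, by rw [sign_pos h0]⟩)
        · refine .inl ⟨_, ⟨x, rfl⟩, ?_⟩
          simp only [c', if_neg hs, ← hc _ hs x rfl]
      calc (Set.range fun x i => SignType.sign (f i x)).ncard
          ≤ _ := Set.ncard_le_ncard hsub (Set.toFinite _)
        _ ≤ A.ncard + (A₀.ncard + A₀.ncard) :=
            (Set.ncard_union_le _ _).trans (add_le_add (Set.ncard_image_le (Set.toFinite _))
              ((Set.ncard_union_le _ _).trans (add_le_add (Set.ncard_image_le (Set.toFinite _))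
                (Set.ncard_image_le (Set.toFinite _)))))
        _ ≤ (2 * M + 1) ^ (N + 1) + ((2 * M + 1) ^ N + (2 * M + 1) ^ N) := by gcongr
        -- The base `2 M + 1` is chosen so that the two extra copies of `A₀` raise one factor to `2
        -- (M + 1) + 1`.
        _ = (2 * M + 1) ^ N * (2 * (M + 1) + 1) := by ring
        _ ≤ (2 * (M + 1) + 1) ^ N * (2 * (M + 1) + 1) := by gcongr; omega
        _ = _ := (pow_succ _ _).symm

theorem ncard_range_sign_le {κ E : Type*} [Fintype κ] [AddCommGroup E] [Module ℝ E]
    [FiniteDimensional ℝ E] (f : κ → E →ₗ[ℝ] ℝ) :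
    (Set.range fun x i => SignType.sign (f i x)).ncard ≤
      (2 * Fintype.card κ + 1) ^ Module.finrank ℝ E := by
  refine le_trans ?_ (ncard_range_sign_fin_le (fun i => f ((Fintype.equivFin κ).symm i)) le_rfl)
  refine (Set.ncard_le_ncard ?_ (Set.toFinite _)).trans
    (Set.ncard_image_le (f := fun s i => s (Fintype.equivFin κ i)) (Set.toFinite _))
  rintro _ ⟨x, rfl⟩
  exact ⟨_, ⟨x, rfl⟩, by simp⟩

/-! ### The surrogate optimum depends on finitely many signs -/

/-- Moving slightly from `c` away from `d` stays feasible: a constraint active at `c` is constant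
along the line, and the others have slack. -/
theorem exists_pos_forall_le_of_active {k : ℕ} {c d b : Fin k → ℝ} (hc : ∀ i, c i ≤ b i)
    (hcd : ∀ i, c i = b i → d i = b i) :
    ∃ ε > 0, ∀ i, c i + ε * (c i - d i) ≤ b i := by
  have h : ∀ i, ∀ᶠ ε in nhdsWithin (0 : ℝ) (Set.Ioi 0), c i + ε * (c i - d i) ≤ b i := by
    intro i
    rcases (hc i).eq_or_lt with hi | hi
    · simp [hcd i hi, hi]
    · have ht : Filter.Tendsto (fun ε : ℝ => c i + ε * (c i - d i)) (nhdsWithin 0 (Set.Ioi 0))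
          (nhds (c i)) := by
        have : ContinuousAt (fun ε : ℝ => c i + ε * (c i - d i)) 0 := by fun_prop
        have h0 := this.tendsto.mono_left (nhdsWithin_le_nhds (s := Set.Ioi 0))
        simpa using h0
      exact (ht.eventually (gt_mem_nhds hi)).mono fun _ h => le_of_lt h
  obtain ⟨ε, hε, hpos⟩ := ((Filter.eventually_all.2 h).and self_mem_nhdsWithin).exists
  exact ⟨ε, hpos, hε⟩

/-- The feasible `y` may form an unbounded set, so the minimum is taken over the compact set of
decisions `P y` in `S`. -/
theorem surrogateArgmin_nonempty {n m : ℕ} {S : Set (Vec n)} (hS : IsCompact S)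
    {P : Matrix (Fin n) (Fin m) ℝ} (hfeas : ∃ y : Vec m, lin P y ∈ S) (η : Vec n) :
    (surrogateArgmin S P η).Nonempty := by
  have hcl : IsClosed (LinearMap.range (lin P).toLinearMap : Set (Vec n)) :=
    Submodule.closed_of_finiteDimensional _
  obtain ⟨y₀, hy₀⟩ := hfeas
  obtain ⟨x, ⟨hxS, y, rfl⟩, hx⟩ := (hS.inter_right hcl).exists_isMinOn ⟨lin P y₀, hy₀, y₀, rfl⟩
    (f := fun x => ⟪η, x⟫) (by fun_prop)
  exact ⟨y, hxS, fun y' hy' => hx ⟨hy', y', rfl⟩⟩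

theorem exists_surrogateArgmin_eq_of_sign {n m : ℕ} {S : Set (Vec n)} (hS : IsCompact S)
    (hpoly : IsPolyhedron S) {P : Matrix (Fin n) (Fin m) ℝ}
    (hfeas : ∃ y : Vec m, lin P y ∈ S) :
    ∃ (k : ℕ) (_ : 0 < k) (u : Fin k → Vec m), ∀ η η' : Vec n,
      (∀ j, SignType.sign ⟪η, lin P (u j)⟫ = SignType.sign ⟪η', lin P (u j)⟫) →
        surrogateArgmin S P η = surrogateArgmin S P η' := by
  classical
  obtain ⟨k, a, b, rfl⟩ := hpoly
  set S : Set (Vec n) := {x | ∀ i, ⟪a i, x⟫ ≤ b i} with hSdef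
  let act : Vec m → Finset (Fin k) := fun y => Finset.univ.filter fun i => ⟪a i, lin P y⟫ = b i
  -- If no feasible point has active set `J`, any feasible point serves as the representative.
  have hrep : ∀ J : Finset (Fin k), ∃ x : Vec m, lin P x ∈ S ∧
      ∀ y, lin P y ∈ S → act y = J → act x = J := by
    intro J
    by_cases h : ∃ y, lin P y ∈ S ∧ act y = J
    · obtain ⟨y, hy, hJ⟩ := h
      exact ⟨y, hy, fun _ _ _ => hJ⟩
    · obtain ⟨y, hy⟩ := hfeas
      exact ⟨y, hy, fun y' hy' hJ => (h ⟨y', hy', hJ⟩).elim⟩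
  choose x hxS hxact using hrep
  -- Optimality depends only on the active set: the segment from `y'` to `y` can be prolonged beyond
  -- `y`, so if `y'` were worse than `y`, the prolonged point would beat `y`.
  have hle : ∀ η y y', lin P y ∈ S → lin P y' ∈ S → act y = act y' →
      y ∈ surrogateArgmin S P η → y' ∈ surrogateArgmin S P η := by
    intro η y y' hy hy' hact hopt
    obtain ⟨ε, hε, hle⟩ := exists_pos_forall_le_of_active (c := fun i => ⟪a i, lin P y⟫)
      (d := fun i => ⟪a i, lin P y'⟫) (b := b) hy (fun i hi => by
        have : i ∈ act y' := hact ▸ by simpa [act] using hi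
        simpa [act] using this)
    have hmem : lin P (y + ε • (y - y')) ∈ S := fun i => by
      simpa [map_add, map_smul, map_sub, inner_add_right, inner_smul_right, inner_sub_right]
        using hle i
    have h := hopt.2 _ hmem
    simp only [map_add, map_smul, map_sub, inner_add_right, inner_smul_right,
      inner_sub_right] at h
    have h' : ⟪η, lin P y'⟫ ≤ ⟪η, lin P y⟫ := by nlinarith
    exact ⟨hy', fun w hw => h'.trans (hopt.2 w hw)⟩
  have hchar : ∀ η y, y ∈ surrogateArgmin S P η ↔
      lin P y ∈ S ∧ ∀ J, 0 ≤ ⟪η, lin P (x J - x (act y))⟫ := by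
    intro η y
    constructor
    · intro hy
      have hx := hle η y (x (act y)) hy.1 (hxS _) (hxact _ y hy.1 rfl).symm hy
      refine ⟨hy.1, fun J => ?_⟩
      rw [map_sub, inner_sub_right, sub_nonneg]
      exact hx.2 _ (hxS J)
    · rintro ⟨hy, hJ⟩
      obtain ⟨y₀, hy₀⟩ := surrogateArgmin_nonempty hS hfeas η
      have hx₀ := hle η y₀ (x (act y₀)) hy₀.1 (hxS _) (hxact _ y₀ hy₀.1 rfl).symm hy₀
      have h := hJ (act y₀)
      rw [map_sub, inner_sub_right, sub_nonneg] at h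
      exact hle η (x (act y)) y (hxS _) hy (hxact _ y hy rfl)
        ⟨hxS _, fun w hw => h.trans (hx₀.2 w hw)⟩
  -- The vectors `u_j` are all differences of two representatives.
  let e := Fintype.equivFin (Finset (Fin k) × Finset (Fin k))
  refine ⟨_, Fintype.card_pos, fun j => x (e.symm j).1 - x (e.symm j).2, fun η η' h => ?_⟩
  ext y
  rw [hchar, hchar]
  refine and_congr_right fun _ => forall_congr' fun J => ?_
  have := h (e (J, act y))
  simp only [Equiv.symm_apply_apply] at this
  rw [← sign_nonneg_iff, this, sign_nonneg_iff]

/-! ### Bounds for the empirical Rademacher complexity -/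

section Rademacher

variable {Z A : Type*} {t : ℕ} {H : Set A} {ℓ : A → Z → ℝ} {z : Fin t → Z}

theorem abs_rademacher_sum_le {a : Fin t → ℝ} {C : ℝ} (hC : ∀ i, |a i| ≤ C) (ht : 1 ≤ t)
    (σ : Fin t → ℤˣ) : |(1 / (t : ℝ)) * ∑ i, ((σ i : ℤ) : ℝ) * a i| ≤ C := by
  have ht' : (0 : ℝ) < t := by exact_mod_cast ht
  have h : |∑ i, ((σ i : ℤ) : ℝ) * a i| ≤ t * C := by
    calc |∑ i, ((σ i : ℤ) : ℝ) * a i| ≤ ∑ i, |((σ i : ℤ) : ℝ) * a i| :=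
          Finset.abs_sum_le_sum_abs _ _
      _ ≤ ∑ _i : Fin t, C := Finset.sum_le_sum fun i _ => by
          rcases Int.units_eq_one_or (σ i) with h | h <;> simpa [h] using hC i
      _ = t * C := by simp
  rw [abs_mul, abs_of_pos (by positivity)]
  calc 1 / (t : ℝ) * |∑ i, ((σ i : ℤ) : ℝ) * a i| ≤ 1 / t * (t * C) := by gcongr
    _ = C := by field_simp

theorem abs_empiricalRademacher_le (hH : H.Nonempty) {C : ℝ}
    (hC : ∀ Φ ∈ H, ∀ i, |ℓ Φ (z i)| ≤ C) (ht : 1 ≤ t) : |empiricalRademacher H ℓ z| ≤ C := by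
  have : Nonempty H := hH.to_subtype
  have hsup : ∀ σ : Fin t → ℤˣ,
      |⨆ Φ : H, (1 / (t : ℝ)) * ∑ i, ((σ i : ℤ) : ℝ) * ℓ Φ (z i)| ≤ C := by
    intro σ
    have hb := fun Φ : H => abs_le.1 (abs_rademacher_sum_le (hC Φ Φ.2) ht σ)
    obtain ⟨Φ⟩ := this
    exact abs_le.2 ⟨(hb Φ).1.trans (le_ciSup (f := fun Φ : H => (1 / (t : ℝ)) *
      ∑ i, ((σ i : ℤ) : ℝ) * ℓ Φ (z i)) ⟨C, by rintro _ ⟨Φ, rfl⟩; exact (hb Φ).2⟩ Φ),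
      have : Nonempty H := ⟨Φ⟩; ciSup_le fun Φ => (hb Φ).2⟩
  rw [empiricalRademacher, abs_div, abs_of_pos (by positivity : (0 : ℝ) < 2 ^ t),
    div_le_iff₀ (by positivity)]
  calc _ ≤ ∑ _σ : Fin t → ℤˣ, C :=
        (Finset.abs_sum_le_sum_abs _ _).trans (Finset.sum_le_sum fun σ _ => hsup σ)
    _ = C * 2 ^ t := by simp [mul_comm]

theorem sum_signs_eq_zero (c : Fin t → ℝ) :
    ∑ σ : Fin t → ℤˣ, ∑ i, ((σ i : ℤ) : ℝ) * c i = 0 := by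
  have h := Equiv.sum_comp (Equiv.neg (Fin t → ℤˣ)) fun σ => ∑ i, ((σ i : ℤ) : ℝ) * c i
  simp only [Equiv.neg_apply, Pi.neg_apply, Units.val_neg, Int.cast_neg, neg_mul,
    Finset.sum_neg_distrib] at h
  linarith

/-- A term that depends only on the sample does not change the Rademacher complexity. -/
theorem empiricalRademacher_sub (hH : H.Nonempty) (c : Z → ℝ) {C : ℝ}
    (hC : ∀ Φ ∈ H, ∀ i, |ℓ Φ (z i) - c (z i)| ≤ C) (ht : 1 ≤ t) :
    empiricalRademacher H (fun Φ z => ℓ Φ z - c z) z = empiricalRademacher H ℓ z := by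
  have : Nonempty H := hH.to_subtype
  have hσ : ∀ σ : Fin t → ℤˣ,
      (⨆ Φ : H, (1 / (t : ℝ)) * ∑ i, ((σ i : ℤ) : ℝ) * ℓ Φ (z i)) =
        (⨆ Φ : H, (1 / (t : ℝ)) * ∑ i, ((σ i : ℤ) : ℝ) * (ℓ Φ (z i) - c (z i))) +
          (1 / (t : ℝ)) * ∑ i, ((σ i : ℤ) : ℝ) * c (z i) := by
    intro σ
    rw [ciSup_add ⟨C, by
      rintro _ ⟨Φ, rfl⟩
      exact (abs_le.1 (abs_rademacher_sum_le (hC Φ Φ.2) ht σ)).2⟩]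
    refine iSup_congr fun Φ => ?_
    rw [← mul_add, ← Finset.sum_add_distrib]
    congr 1
    exact Finset.sum_congr rfl fun i _ => by ring
  simp only [empiricalRademacher, hσ, Finset.sum_add_distrib, ← Finset.mul_sum,
    sum_signs_eq_zero, mul_zero, add_zero]

/-- The sum over sign vectors factors over coordinates into `2 cosh (a i)`, and `cosh x ≤ exp (x² /
2)`. -/
theorem sum_exp_signs_le (a : Fin t → ℝ) {C : ℝ} (ha : ∀ i, |a i| ≤ C) :
    ∑ σ : Fin t → ℤˣ, Real.exp (∑ i, ((σ i : ℤ) : ℝ) * a i) ≤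
      2 ^ t * Real.exp (t * (C ^ 2 / 2)) := by
  have h1 : ∑ σ : Fin t → ℤˣ, Real.exp (∑ i, ((σ i : ℤ) : ℝ) * a i) =
      ∏ i, ∑ s : ℤˣ, Real.exp (((s : ℤ) : ℝ) * a i) := by
    simp only [Real.exp_sum, Finset.prod_univ_sum, Fintype.piFinset_univ]
  have h2 : ∀ i, ∑ s : ℤˣ, Real.exp (((s : ℤ) : ℝ) * a i) ≤ 2 * Real.exp (C ^ 2 / 2) := by
    intro i
    have : ∑ s : ℤˣ, Real.exp (((s : ℤ) : ℝ) * a i) = 2 * Real.cosh (a i) := by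
      rw [UnitsInt.univ, Finset.sum_pair (by decide), Real.cosh_eq]
      simp
      ring
    rw [this]
    have hsq : a i ^ 2 ≤ C ^ 2 := sq_le_sq' (abs_le.1 (ha i)).1 (abs_le.1 (ha i)).2
    have := (Real.cosh_le_exp_half_sq (a i)).trans
      (Real.exp_le_exp.2 (by linarith : a i ^ 2 / 2 ≤ C ^ 2 / 2))
    linarith
  rw [h1]
  calc _ ≤ ∏ _i : Fin t, (2 * Real.exp (C ^ 2 / 2)) :=
        Finset.prod_le_prod (fun i _ => by positivity) fun i _ => h2 i
    _ = _ := by simp [mul_pow, ← Real.exp_nat_mul]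

/-- Jensen's inequality for the exponential and the uniform average. -/
theorem average_le_of_sum_exp_le {ι : Type*} [Fintype ι] {X : ι → ℝ} {c N : ℝ} (hN : 0 < N)
    (hcard : (Fintype.card ι : ℝ) = N) (h : ∑ i, Real.exp (X i) ≤ N * Real.exp c) :
    (∑ i, X i) / N ≤ c := by
  rw [div_le_iff₀ hN]
  -- Tangent line of the exponential at `c`, divided by `exp c`.
  have h1 : ∑ i, (X i - c + 1) ≤ ∑ i, Real.exp (X i) * Real.exp (-c) :=
    Finset.sum_le_sum fun i _ => by
      rw [← Real.exp_add, ← sub_eq_add_neg]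
      exact Real.add_one_le_exp _
  rw [← Finset.sum_mul, Finset.sum_add_distrib, Finset.sum_sub_distrib] at h1
  simp only [Finset.sum_const, Finset.card_univ, nsmul_eq_mul, hcard, mul_one] at h1
  have h2 := mul_le_mul_of_nonneg_right h (Real.exp_pos (-c)).le
  rw [mul_assoc, ← Real.exp_add, add_neg_cancel, Real.exp_zero, mul_one] at h2
  linarith

/-- Massart's finite class lemma. -/
theorem empiricalRademacher_le_of_ncard_le (hH : H.Nonempty) {C L : ℝ}
    (hC : ∀ Φ ∈ H, ∀ i, |ℓ Φ (z i)| ≤ C) (ht : 1 ≤ t)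
    (hfin : (Set.range fun (Φ : H) i => ℓ Φ (z i)).Finite) (hL : 0 < L)
    (hcard : ((Set.range fun (Φ : H) i => ℓ Φ (z i)).ncard : ℝ) ≤ Real.exp L) :
    empiricalRademacher H ℓ z ≤ C * √(2 * L / t) := by
  have : Nonempty H := hH.to_subtype
  have ht' : (0 : ℝ) < t := by exact_mod_cast ht
  have habs := (abs_le.1 (abs_empiricalRademacher_le hH hC ht)).2
  have hC0 : 0 ≤ C := (abs_nonneg _).trans (abs_empiricalRademacher_le hH hC ht)
  rcases hC0.eq_or_lt with rfl | hCpos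
  · simpa using habs
  set W := hfin.toFinset with hW
  set X : (Fin t → ℤˣ) → ℝ := fun σ =>
    ⨆ Φ : H, (1 / (t : ℝ)) * ∑ i, ((σ i : ℤ) : ℝ) * ℓ Φ (z i) with hX
  -- An attained supremum lets `exp (s * X σ)` be bounded by the sum of exponentials over all loss
  -- vectors in `W`.
  have hattain : ∀ σ, ∃ Φ : H, (1 / (t : ℝ)) * ∑ i, ((σ i : ℤ) : ℝ) * ℓ Φ (z i) = X σ := by
    intro σ
    have hf : (Set.range fun Φ : H => (1 / (t : ℝ)) * ∑ i, ((σ i : ℤ) : ℝ) * ℓ Φ (z i)).Finite := by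
      refine (hfin.image fun w => (1 / (t : ℝ)) * ∑ i, ((σ i : ℤ) : ℝ) * w i).subset ?_
      rintro _ ⟨Φ, rfl⟩
      exact ⟨_, ⟨Φ, rfl⟩, rfl⟩
    exact (Set.range_nonempty _).csSup_mem hf
  have key : ∀ s > 0, s * empiricalRademacher H ℓ z ≤ L + t * ((s / t * C) ^ 2 / 2) := by
    intro s hs
    have hexp : ∑ σ, Real.exp (s * X σ) ≤
        2 ^ t * Real.exp (L + t * ((s / t * C) ^ 2 / 2)) := by
      calc ∑ σ, Real.exp (s * X σ)
          ≤ ∑ σ : Fin t → ℤˣ, ∑ w ∈ W, Real.exp (∑ i, ((σ i : ℤ) : ℝ) * (s / t * w i)) := by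
            refine Finset.sum_le_sum fun σ _ => ?_
            obtain ⟨Φ, hΦ⟩ := hattain σ
            refine le_trans (le_of_eq ?_) (Finset.single_le_sum
              (f := fun w : Fin t → ℝ => Real.exp (∑ i, ((σ i : ℤ) : ℝ) * (s / t * w i)))
              (fun _ _ => (Real.exp_pos _).le) (hfin.mem_toFinset.2 ⟨Φ, rfl⟩))
            rw [← hΦ]
            congr 1
            rw [← mul_assoc, Finset.mul_sum]
            exact Finset.sum_congr rfl fun i _ => by ring
        _ = ∑ w ∈ W, ∑ σ : Fin t → ℤˣ, Real.exp (∑ i, ((σ i : ℤ) : ℝ) * (s / t * w i)) :=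
            Finset.sum_comm
        _ ≤ ∑ w ∈ W, 2 ^ t * Real.exp (t * ((s / t * C) ^ 2 / 2)) := by
            refine Finset.sum_le_sum fun w hw => sum_exp_signs_le _ fun i => ?_
            obtain ⟨Φ, rfl⟩ := hfin.mem_toFinset.1 hw
            rw [abs_mul, abs_of_pos (by positivity)]
            exact mul_le_mul_of_nonneg_left (hC Φ Φ.2 i) (by positivity)
        _ = W.card * (2 ^ t * Real.exp (t * ((s / t * C) ^ 2 / 2))) := by simp
        _ ≤ Real.exp L * (2 ^ t * Real.exp (t * ((s / t * C) ^ 2 / 2))) := by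
            gcongr
            rwa [hW, ← Set.ncard_eq_toFinset_card _ hfin]
        _ = _ := by rw [Real.exp_add]; ring
    have := average_le_of_sum_exp_le (by positivity) (by simp) hexp
    rwa [← Finset.mul_sum, mul_div_assoc] at this
  set r := √(2 * L / t) with hr
  have hr0 : 0 < r := Real.sqrt_pos.2 (by positivity)
  have hr2 : r ^ 2 * t = 2 * L := by
    rw [hr, Real.sq_sqrt (by positivity)]
    field_simp
  -- This `s` minimizes `L / s + s C² / (2 t)`; it makes the two terms equal.
  have h := key (t * r / C) (by positivity)
  have h2 : t * ((t * r / C / t * C) ^ 2 / 2) = L := by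
    rw [show t * r / C / t * C = r by field_simp]
    linarith
  rw [h2, ← two_mul, ← hr2] at h
  have h3 : t * r / C * empiricalRademacher H ℓ z ≤ t * r / C * (C * r) := by
    refine h.trans (le_of_eq ?_)
    field_simp
  exact le_of_mul_le_mul_left h3 (by positivity)

end Rademacher

/-! ### Measurability -/

theorem _root_.IsLocallyClosed.isSigmaCompact {X : Type*} [TopologicalSpace X]
    [LocallyCompactSpace X] [SecondCountableTopology X] {s : Set X} (hs : IsLocallyClosed s) :
    IsSigmaCompact s := by
  have := hs.locallyCompactSpace
  exact isSigmaCompact_iff_sigmaCompactSpace.2 inferInstance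

theorem _root_.IsSigmaCompact.measurableSet {X : Type*} [TopologicalSpace X] [T2Space X]
    [MeasurableSpace X] [OpensMeasurableSpace X] {s : Set X} (hs : IsSigmaCompact s) :
    MeasurableSet s := by
  obtain ⟨K, hK, rfl⟩ := hs
  exact MeasurableSet.iUnion fun i => (hK i).measurableSet

/-- Nonzero signs are open conditions and zero signs are closed ones. -/
theorem isLocallyClosed_sign_eq {X κ : Type*} [TopologicalSpace X] [Finite κ] {h : κ → X → ℝ}
    (hh : ∀ i, Continuous (h i)) (q : κ → SignType) :
    IsLocallyClosed {x | ∀ i, SignType.sign (h i x) = q i} := by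
  have h1 : {x | ∀ i, SignType.sign (h i x) = q i} =
      (⋂ i, {x | q i = 1 → 0 < h i x}) ∩ (⋂ i, {x | q i = -1 → h i x < 0}) ∩
        ⋂ i, {x | q i = 0 → h i x = 0} := by
    ext x
    simp only [Set.mem_ofPred_eq, Set.mem_inter_iff, Set.mem_iInter, ← forall_and]
    refine forall_congr' fun i => ?_
    cases hq : q i
    · simp [sign_eq_zero_iff]
    · simpa using! sign_eq_neg_one_iff
    · simpa using! sign_eq_one_iff
  rw [h1]
  refine ((isOpen_iInter_of_finite fun i => ?_).inter
    (isOpen_iInter_of_finite fun i => ?_)).isLocallyClosed.inter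
    (isClosed_iInter fun i => ?_).isLocallyClosed
  · by_cases hq : q i = 1
    · simpa [hq] using isOpen_lt continuous_const (hh i)
    · simp [hq]
  · by_cases hq : q i = -1
    · simpa [hq] using isOpen_lt (hh i) continuous_const
    · simp [hq]
  · by_cases hq : q i = 0
    · simpa [hq] using isClosed_eq (hh i) continuous_const
    · simp [hq]

theorem lin_apply {n m : ℕ} (P : Matrix (Fin n) (Fin m) ℝ) (y : Vec m) (i : Fin n) :
    lin P y i = ∑ j, P i j * y j := rfl

/-- A projection of a Borel set need not be Borel. Here the set of pairs of sample and matrix is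
locally closed, hence σ-compact, and σ-compactness passes to continuous images. -/
theorem measurableSet_exists_sign_eq {n p t k : ℕ} (w : Fin k → Vec n)
    (q : Fin t → Fin k → SignType) :
    MeasurableSet {z : Fin t → Vec p × Vec n | ∃ B : Matrix (Fin n) (Fin p) ℝ,
      ∀ i j, SignType.sign ⟪lin B (z i).1, w j⟫ = q i j} := by
  have hlc := isLocallyClosed_sign_eq (κ := Fin t × Fin k)
    (X := (Fin t → Vec p × Vec n) × (Fin n → Fin p → ℝ))
    (h := fun ij x => ⟪lin (Matrix.of x.2) (x.1 ij.1).1, w ij.2⟫) (fun ij => by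
      simp only [PiLp.inner_apply, lin_apply, Matrix.of_apply]
      fun_prop) (fun ij => q ij.1 ij.2)
  have := (hlc.isSigmaCompact.image continuous_fst).measurableSet
  convert this using 1
  ext z
  simp only [Set.mem_ofPred_eq, Set.mem_image, Prod.exists, exists_and_right, exists_eq_right,
    Prod.forall]
  exact Iff.rfl

/-- The supremum over an uncountable class is a maximum over the finitely many sign patterns
realizable on the sample, so its superlevel sets are finite unions of measurable sets. -/
theorem measurable_empiricalRademacher {n p t k : ℕ} (w : Fin k → Vec n)
    (g : (Fin k → SignType) → Vec n) (ℓ : (Vec p → Vec n) → Vec p × Vec n → ℝ)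
    (hℓ : ∀ Φ z, ℓ Φ z = ⟪z.2, g fun j => SignType.sign ⟪Φ z.1, w j⟫⟫) :
    Measurable fun z : Fin t → Vec p × Vec n =>
      empiricalRademacher (linearHypotheses p n) ℓ z := by
  have hne : Nonempty (linearHypotheses p n) := ⟨⟨_, 0, rfl⟩⟩
  refine (Finset.measurable_sum _ fun σ _ => measurable_of_Ioi fun c => ?_).div_const _
  have : (fun z : Fin t → Vec p × Vec n => ⨆ Φ : linearHypotheses p n,
        (1 / (t : ℝ)) * ∑ i, ((σ i : ℤ) : ℝ) * ℓ Φ (z i)) ⁻¹' Set.Ioi c =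
      ⋃ q : Fin t → Fin k → SignType,
        {z : Fin t → Vec p × Vec n | ∃ B : Matrix (Fin n) (Fin p) ℝ,
          ∀ i j, SignType.sign ⟪lin B (z i).1, w j⟫ = q i j} ∩
        {z | c < (1 / (t : ℝ)) * ∑ i, ((σ i : ℤ) : ℝ) * ⟪(z i).2, g (q i)⟫} := by
    ext z
    have hbdd : BddAbove (Set.range fun Φ : linearHypotheses p n =>
        (1 / (t : ℝ)) * ∑ i, ((σ i : ℤ) : ℝ) * ℓ Φ (z i)) := by
      refine ((Set.finite_range fun q : Fin t → Fin k → SignType => (1 / (t : ℝ)) *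
        ∑ i, ((σ i : ℤ) : ℝ) * ⟪(z i).2, g (q i)⟫).subset ?_).bddAbove
      rintro _ ⟨Φ, rfl⟩
      exact ⟨fun i j => SignType.sign ⟪Φ.1 (z i).1, w j⟫, by simp only [hℓ]⟩
    rw [Set.mem_preimage, Set.mem_Ioi, lt_ciSup_iff hbdd]
    simp only [Set.mem_iUnion, Set.mem_inter_iff, Set.mem_ofPred_eq, hℓ]
    constructor
    · rintro ⟨⟨_, B, rfl⟩, h⟩
      exact ⟨_, ⟨B, fun _ _ => rfl⟩, h⟩
    · rintro ⟨q, ⟨B, hB⟩, h⟩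
      refine ⟨⟨_, B, rfl⟩, ?_⟩
      simpa only [hB] using h
  rw [this]
  refine MeasurableSet.iUnion fun q => (measurableSet_exists_sign_eq w q).inter
    (measurableSet_lt measurable_const ?_)
  fun_prop

/-! ### The decision loss of linear hypotheses -/

theorem abs_inner_sub_le_gap {n : ℕ} {S : Set (Vec n)} (hS : IsCompact S) (θ : Vec n)
    {x y : Vec n} (hx : x ∈ S) (hy : y ∈ S) : |⟪θ, x⟫ - ⟪θ, y⟫| ≤ gap S θ := by
  have hc : IsCompact ((fun x => ⟪θ, x⟫) '' S) := hS.image (by fun_prop)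
  have h1 := fun {v} (hv : v ∈ S) => le_csSup hc.bddAbove (Set.mem_image_of_mem (⟪θ, ·⟫) hv)
  have h2 := fun {v} (hv : v ∈ S) => csInf_le hc.bddBelow (Set.mem_image_of_mem (⟪θ, ·⟫) hv)
  have := h1 hx
  have := h1 hy
  have := h2 hx
  have := h2 hy
  rw [gap, abs_le]
  constructor <;> linarith

/-- On a sample of size `t`, the sign patterns of `⟪B ξᵢ, P uⱼ⟫` over all linear hypotheses `B` are
those of linear functionals of the `m × p` matrix `Pᵀ B`. -/
theorem ncard_range_sign_linearHypotheses_le {n m p t k : ℕ} (P : Matrix (Fin n) (Fin m) ℝ)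
    (u : Fin k → Vec m) (ξ : Fin t → Vec p) :
    (Set.range fun (Φ : linearHypotheses p n) (ij : Fin t × Fin k) =>
      SignType.sign ⟪Φ.1 (ξ ij.1), lin P (u ij.2)⟫).ncard ≤ (2 * (t * k) + 1) ^ (m * p) := by
  have h := ncard_range_sign_le (κ := Fin t × Fin k) (E := Vec p →ₗ[ℝ] Vec m)
    fun ij => (innerₗ (Vec m)).flip (u ij.2) ∘ₗ LinearMap.applyₗ (ξ ij.1)
  rw [Module.finrank_linearMap, finrank_euclideanSpace_fin, finrank_euclideanSpace_fin,
    Fintype.card_prod, Fintype.card_fin, Fintype.card_fin, mul_comm p m] at h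
  refine (Set.ncard_le_ncard ?_ (Set.toFinite _)).trans h
  rintro _ ⟨⟨_, B, rfl⟩, rfl⟩
  refine ⟨((lin P).adjoint ∘L lin B).toLinearMap, ?_⟩
  funext ij
  exact congrArg _ (ContinuousLinearMap.adjoint_inner_left (lin P) (u ij.2) (lin B (ξ ij.1)))

/-- In the degenerate cases the decision does not depend on the hypothesis. -/
theorem lin_sel_eq_of_degenerate {n m p : ℕ} {S : Set (Vec n)} (hS : IsCompact S)
    {P : Matrix (Fin n) (Fin m) ℝ} {sel : Set (Vec m) → Vec m}
    (hsel : ∀ η, lin P (sel (surrogateArgmin S P η)) ∈ S)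
    (hdeg : m = 0 ∨ p = 0 ∨ ‖pinv (lin P)‖ = 0 ∨ Metric.diam S = 0)
    {Φ Ψ : Vec p → Vec n} (hΦ : Φ ∈ linearHypotheses p n) (hΨ : Ψ ∈ linearHypotheses p n)
    (ξ : Vec p) :
    lin P (sel (surrogateArgmin S P (Φ ξ))) = lin P (sel (surrogateArgmin S P (Ψ ξ))) := by
  rcases hdeg with rfl | rfl | h | h
  · congr 1
    exact Subsingleton.elim _ _
  · obtain ⟨B, rfl⟩ := hΦ
    obtain ⟨B', rfl⟩ := hΨ
    rw [Subsingleton.elim ξ 0, map_zero, map_zero]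
  -- `P = P P⁺ P` vanishes together with `P⁺`.
  · have h0 : lin P = 0 := by
      rw [← (pinv_penrose (lin P)).1, norm_eq_zero.1 h]
      simp
    simp [h0]
  · exact dist_le_zero.1 (h ▸ Metric.dist_le_diam_of_mem hS.isBounded (hsel _) (hsel _))

/-- Compares Massart's exponent with the claimed one. It suffices that `log (2 k + 1) + log t ≤ 4 m
(log κ + log t)`, and the surplus `(4 m - 1) log t` covers the constants above the threshold on `t`.
-/
theorem log_pow_le_of_le_log {m p t k : ℕ} {κ : ℝ} (hm : 1 ≤ m) (hκ : 0 < κ) (ht : 1 ≤ t)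
    (hlog : Real.log (2 * k + 1) + 4 * m * |Real.log κ| ≤ Real.log t) :
    (m * p : ℕ) * Real.log (2 * (t * k) + 1) ≤ (2 * m) ^ 2 * (p * Real.log (κ * t)) := by
  have ht' : (1 : ℝ) ≤ t := by exact_mod_cast ht
  have hm' : (1 : ℝ) ≤ m := by exact_mod_cast hm
  have h1 : Real.log (2 * (t * k) + 1) ≤ Real.log (2 * k + 1) + Real.log t := by
    rw [← Real.log_mul (by positivity) (by positivity)]
    exact Real.log_le_log (by positivity) (by nlinarith)
  have h2 : Real.log (κ * t) = Real.log κ + Real.log t :=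
    Real.log_mul hκ.ne' (by positivity)
  have h3 : 0 ≤ 4 * (m : ℝ) * (|Real.log κ| + Real.log κ) :=
    mul_nonneg (by positivity) (by linarith [neg_abs_le (Real.log κ)])
  have h4 : 0 ≤ (m - 1) * Real.log t := mul_nonneg (by linarith) (Real.log_nonneg ht')
  have h5 : 0 ≤ Real.log t := Real.log_nonneg ht'
  have h6 : Real.log (2 * (t * k) + 1) ≤ 4 * m * Real.log (κ * t) := by
    rw [h2]
    nlinarith
  push_cast
  calc (m : ℝ) * p * Real.log (2 * (t * k) + 1) ≤ m * p * (4 * m * Real.log (κ * t)) := by gcongr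
    _ = _ := by ring

/-- For a sample with parameters of gap at most `C`, the empirical Rademacher complexity of the
decision loss is at most `C`, it is nonpositive in the degenerate cases, and Massart's lemma
applies. -/
theorem empiricalRademacher_decisionLoss_bounds {n m p t k : ℕ} {S : Set (Vec n)}
    (hS : IsCompact S) {P : Matrix (Fin n) (Fin m) ℝ} {sel : Set (Vec m) → Vec m}
    (hsel : ∀ η, lin P (sel (surrogateArgmin S P η)) ∈ S)
    {u : Fin k → Vec m} {g : (Fin k → SignType) → Vec n}
    (hg : ∀ η, lin P (sel (surrogateArgmin S P η)) =
      g fun j => SignType.sign ⟪η, lin P (u j)⟫)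
    {z : Fin t → Vec p × Vec n} {C : ℝ} (hC : ∀ i, gap S (z i).2 ≤ C) (ht : 1 ≤ t) :
    |empiricalRademacher (linearHypotheses p n) (decisionLoss S P sel) z| ≤ C ∧
    ((m = 0 ∨ p = 0 ∨ ‖pinv (lin P)‖ = 0 ∨ Metric.diam S = 0) →
      empiricalRademacher (linearHypotheses p n) (decisionLoss S P sel) z ≤ 0) ∧
    ∀ L : ℝ, 0 < L → (m * p : ℕ) * Real.log (2 * (t * k) + 1) ≤ L →
      empiricalRademacher (linearHypotheses p n) (decisionLoss S P sel) z ≤ C * √(2 * L / t) := by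
  have hH : (linearHypotheses p n).Nonempty := ⟨_, 0, rfl⟩
  obtain ⟨Φ₀, hΦ₀⟩ := hH
  have hH : (linearHypotheses p n).Nonempty := ⟨Φ₀, hΦ₀⟩
  -- The gap bounds differences of losses only, not the losses themselves, hence the centring at
  -- `Φ₀`.
  have hbd : ∀ Φ ∈ linearHypotheses p n, ∀ i,
      |decisionLoss S P sel Φ (z i) - decisionLoss S P sel Φ₀ (z i)| ≤ C := fun Φ _ i =>
    (abs_inner_sub_le_gap hS _ (hsel _) (hsel _)).trans (hC i)
  have hsub := empiricalRademacher_sub hH (decisionLoss S P sel Φ₀) hbd ht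
  rw [← hsub]
  refine ⟨abs_empiricalRademacher_le hH hbd ht, fun hdeg => ?_, fun L hL hle => ?_⟩
  · refine (le_abs_self _).trans (abs_empiricalRademacher_le hH (fun Φ hΦ i => ?_) ht)
    rw [decisionLoss, decisionLoss, lin_sel_eq_of_degenerate hS hsel hdeg hΦ hΦ₀, sub_self, abs_zero]
  · let V : (Fin t × Fin k → SignType) → Fin t → ℝ := fun q i =>
      ⟪(z i).2, g fun j => q (i, j)⟫ - decisionLoss S P sel Φ₀ (z i)
    have hrange : (Set.range fun (Φ : linearHypotheses p n) i =>
        decisionLoss S P sel Φ (z i) - decisionLoss S P sel Φ₀ (z i)) ⊆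
        V '' Set.range fun (Φ : linearHypotheses p n) (ij : Fin t × Fin k) =>
          SignType.sign ⟪Φ.1 (z ij.1).1, lin P (u ij.2)⟫ := by
      rintro _ ⟨Φ, rfl⟩
      refine ⟨_, ⟨Φ, rfl⟩, ?_⟩
      funext i
      simp only [V, decisionLoss, hg]
    have hcard := ((Set.ncard_le_ncard hrange (Set.toFinite _)).trans
      (Set.ncard_image_le (Set.toFinite _))).trans
      (ncard_range_sign_linearHypotheses_le P u fun i => (z i).1)
    refine empiricalRademacher_le_of_ncard_le hH hbd ht ((Set.toFinite _).subset hrange) hL ?_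
    calc _ ≤ (((2 * (t * k) + 1) ^ (m * p) : ℕ) : ℝ) := by exact_mod_cast hcard
      _ = Real.exp ((m * p : ℕ) * Real.log (2 * (t * k) + 1)) := by
          rw [← Real.log_pow, Real.exp_log (by positivity)]
          push_cast
          rfl
      _ ≤ Real.exp L := Real.exp_le_exp.2 hle

end SurrogateLearning

/-! ### Assembly of the bound on the expected complexity -/

open SurrogateLearning

theorem mainTheorem1 (n m p : ℕ)
    (S : Set (SurrogateLearning.Vec n)) (hS : IsCompact S)
    (hpoly : SurrogateLearning.IsPolyhedron S)
    (P : Matrix (Fin n) (Fin m) ℝ)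
    (hfeas : ∃ y : SurrogateLearning.Vec m, SurrogateLearning.lin P y ∈ S)
    (Θ : Set (SurrogateLearning.Vec n))
    (hΘ : BddAbove (SurrogateLearning.gap S '' Θ)) :
    ∃ K : ℝ, ∀ sel : Set (SurrogateLearning.Vec m) → SurrogateLearning.Vec m,
      (∀ A : Set (SurrogateLearning.Vec m), A.Nonempty → sel A ∈ A) →
      ∀ (D : Measure (SurrogateLearning.Vec p × SurrogateLearning.Vec n)) [IsProbabilityMeasure D],
        (∀ᵐ z ∂D, z.2 ∈ Θ) →
        ∀ t : ℕ, 1 ≤ t →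
          Integrable
            (fun z : Fin t → SurrogateLearning.Vec p × SurrogateLearning.Vec n =>
              SurrogateLearning.empiricalRademacher (SurrogateLearning.linearHypotheses p n)
                (SurrogateLearning.decisionLoss S P sel) z)
            (Measure.pi fun _ => D) ∧
          SurrogateLearning.expectedRademacher D t (SurrogateLearning.linearHypotheses p n)
              (SurrogateLearning.decisionLoss S P sel) ≤
            2 * m * SurrogateLearning.optimalityGap S Θ *
              Real.sqrt (2 * p * Real.log (2 * m * t *
                ‖SurrogateLearning.pinv (SurrogateLearning.lin P)‖ * Metric.diam S) / t) +
            K / t := by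
  obtain ⟨k, hk, u, hu⟩ := exists_surrogateArgmin_eq_of_sign hS hpoly hfeas
  set C := optimalityGap S Θ with hCdef
  have hC0 : 0 ≤ C := by
    obtain ⟨y, hy⟩ := hfeas
    refine Real.sSup_nonneg ?_
    rintro _ ⟨θ, _, rfl⟩
    exact (abs_nonneg _).trans (abs_inner_sub_le_gap hS θ hy hy)
  set κ := 2 * m * ‖pinv (lin P)‖ * Metric.diam S with hκ
  set c₀ := Real.log (2 * k + 1) + 4 * m * |Real.log κ| with hc₀
  -- `exp c₀` is the threshold on `t` beyond which the main term alone suffices; it depends only on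
  -- `m`, `S` and `P`.
  refine ⟨C * Real.exp c₀, fun sel hsel D _ hD t ht => ?_⟩
  have ht' : (0 : ℝ) < t := by exact_mod_cast ht
  have hmem : ∀ η, lin P (sel (surrogateArgmin S P η)) ∈ S := fun η =>
    (hsel _ (surrogateArgmin_nonempty hS hfeas η)).1
  obtain ⟨g, hg⟩ : ∃ g : (Fin k → SignType) → Vec n, ∀ η,
      lin P (sel (surrogateArgmin S P η)) = g fun j => SignType.sign ⟪η, lin P (u j)⟫ := by
    have hfac : Function.FactorsThrough (fun η => lin P (sel (surrogateArgmin S P η)))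
        (fun η j => SignType.sign ⟪η, lin P (u j)⟫) := fun η η' h => by
      simp only [hu η η' (congrFun h)]
    exact ⟨_, fun η => (hfac.extend_apply (fun _ => 0) η).symm⟩
  have hae : ∀ᵐ z : Fin t → Vec p × Vec n ∂(Measure.pi fun _ => D), ∀ i, gap S (z i).2 ≤ C := by
    refine ae_all_iff.2 fun i => ?_
    filter_upwards [(Measure.tendsto_eval_ae_ae (μ := fun _ : Fin t => D) (i := i)).eventually hD]
      with z hz
    exact le_csSup hΘ ⟨_, hz, rfl⟩
  have hbounds := fun (z : Fin t → Vec p × Vec n) (hz : ∀ i, gap S (z i).2 ≤ C) =>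
    empiricalRademacher_decisionLoss_bounds (P := P) (sel := sel) (u := u) (g := g) hS hmem hg hz ht
  have hint : Integrable (fun z : Fin t → Vec p × Vec n =>
      empiricalRademacher (linearHypotheses p n) (decisionLoss S P sel) z)
      (Measure.pi fun _ => D) := by
    have hmeas := measurable_empiricalRademacher (p := p) (t := t) (fun j => lin P (u j)) g
      (decisionLoss S P sel) fun Φ z => by rw [decisionLoss, hg]
    exact Integrable.of_bound hmeas.aestronglyMeasurable C (hae.mono fun z hz => (hbounds z hz).1)
  refine ⟨hint, ?_⟩
  have hle : ∀ b : ℝ, (∀ z : Fin t → Vec p × Vec n, (∀ i, gap S (z i).2 ≤ C) →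
      empiricalRademacher (linearHypotheses p n) (decisionLoss S P sel) z ≤ b) →
      expectedRademacher D t (linearHypotheses p n) (decisionLoss S P sel) ≤ b := by
    intro b hb
    exact (integral_mono_ae hint (integrable_const b) (hae.mono hb)).trans (by simp)
  -- Outside these cases `κ > 0`, so `log (κ * t)` splits as a sum.
  by_cases hdeg : m = 0 ∨ p = 0 ∨ ‖pinv (lin P)‖ = 0 ∨ Metric.diam S = 0
  · refine (hle 0 fun z hz => (hbounds z hz).2.1 hdeg).trans (by positivity)
  push Not at hdeg
  obtain ⟨hm, hp, hP, hdiam⟩ := hdeg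
  have hκ0 : 0 < κ := by
    have := (norm_nonneg (pinv (lin P))).lt_of_ne' hP
    have := Metric.diam_nonneg.lt_of_ne' hdiam
    have : (0 : ℝ) < m := by exact_mod_cast Nat.pos_of_ne_zero hm
    positivity
  rw [show 2 * m * t * ‖pinv (lin P)‖ * Metric.diam S = κ * t by rw [hκ]; ring]
  rcases le_or_gt c₀ (Real.log t) with hlog | hlog
  · have hkey := log_pow_le_of_le_log (p := p) (Nat.one_le_iff_ne_zero.2 hm) hκ0 ht hlog
    have hL : 0 < (m * p : ℕ) * Real.log (2 * (t * k) + 1) := by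
      have : 0 < t * k := Nat.mul_pos ht hk
      have : (0 : ℝ) < t * k := by exact_mod_cast this
      exact mul_pos (by positivity) (Real.log_pos (by linarith))
    refine (hle _ fun z hz => (hbounds z hz).2.2 _ (hL.trans_le hkey) hkey).trans ?_
    rw [show 2 * ((2 * (m : ℝ)) ^ 2 * (p * Real.log (κ * t))) / t =
      (2 * m) ^ 2 * (2 * p * Real.log (κ * t) / t) by ring, Real.sqrt_mul (by positivity),
      Real.sqrt_sq (by positivity)]
    have : 0 ≤ C * Real.exp c₀ / t := by positivity
    linarith
  -- Here `t < exp c₀`, so the trivial bound `C` is already at most `K / t`.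
  · refine (hle C fun z hz => (abs_le.1 (hbounds z hz).1).2).trans ?_
    have h1 : (t : ℝ) ≤ Real.exp c₀ := ((Real.log_lt_iff_lt_exp ht').1 hlog).le
    have h2 : C ≤ C * Real.exp c₀ / t := by
      rw [le_div_iff₀ ht']
      gcongr
    have h3 : 0 ≤ 2 * m * C * √(2 * p * Real.log (κ * t) / t) := by positivity
    linarith
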